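/- For integers $a,b,c\ge 1$ with $b$ odd, and $z$ in the upper half-plane, let $$F_{a,b,c}(z)=\frac{\eta(24az)^a\,\eta(24acz)^{b-a}}{\eta(24z)},\qquad \eta(z)=q^{1/24}\prod_{n=1}^{\infty}(1-q^n),\quad q=e^{2\pi i z},\quad q^{1/24}=e^{2\pi i z/24}.$$ Call a function $f$ on the upper half-plane lacunary if $f(z)=\sum_{n=0}^{\infty}A(n)q^n$ for all $z$, where the coefficients $A(n)\in\mathbb{C}$ satisfy $$\lim_{x\to\infty}\frac{\#\{0\le n<x : A(n)=0\}}{x}=1 .$$ Then: (1) If $b=3$ and $a\in\{1,2,3\}$, then $F_{a,b,c}$ is lacunary for every integer $c\ge 1$. (2) If $b=5$ and $a\in\{1,2\}$, then $F_{a,b,c}$ is lacunary for every integer $c\ge 1$. In particular, for each $a\in\{1,2,3\}$ there are infinitely many triples $(a,b,c)$, with $b\ge 1$ odd and $c\ge 1$, such that $F_{a,b,c}$ is lacunary. -/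

import Mathlib

/-- A sequence of coefficients `A 0, A 1, …` (of a series `∑ A n q ^ n`) is lacunary if
`#{0 ≤ n < x : A n = 0} / x` tends to `1` as the real number `x` tends to infinity. -/
def LacunaryCoeffs (A : ℕ → ℂ) : Prop :=
  Filter.Tendsto (fun x : ℝ => (({n : ℕ | (n : ℝ) < x ∧ A n = 0}.ncard : ℕ) : ℝ) / x)
    Filter.atTop (nhds 1)

/-- A function `f` on the upper half-plane is lacunary if it is the sum of a power series
`∑ A n q ^ n`, `q = exp (2 π i z)`, converging on the whole upper half-plane, whose coefficients
(which `f` determines) are lacunary. -/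
def IsLacunary (f : UpperHalfPlane → ℂ) : Prop :=
  ∃ A : ℕ → ℂ,
    (∀ z : UpperHalfPlane,
      HasSum (fun n : ℕ => A n * Complex.exp (2 * Real.pi * Complex.I * (z : ℂ)) ^ n) (f z)) ∧
    LacunaryCoeffs A

/-- `F a b c z = η(24 a z) ^ a * η(24 a c z) ^ (b - a) / η(24 z)`, with `b - a` an integer
(possibly negative) and `η` the Dedekind eta function. -/
noncomputable def etaF (a b c : ℕ) (z : UpperHalfPlane) : ℂ :=
  ModularForm.eta (24 * (a : ℂ) * (z : ℂ)) ^ a *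
    ModularForm.eta (24 * (a : ℂ) * (c : ℂ) * (z : ℂ)) ^ ((b : ℤ) - (a : ℤ)) /
      ModularForm.eta (24 * (z : ℂ))

/-!
Write `Q = exp (2 π i z)`. In every case the eta quotient is a theta series in two variables,
`∑ aᵢ Q ^ eᵢ` with exponents satisfying `K eᵢ = u² + D v²` for fixed `K, D ≥ 1`; and the `n` for
which `K n` has this form are of density zero.

*Density.* If `p` is a prime with `p ≡ -1` modulo `4 D`, then `-D` is a nonresidue modulo `p`, so
`p` never divides `u² + D v²` exactly once (`sq_dvd_of_dvd_of_eq`). By the Chinese remainder theorem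
the integers that no prime of a finite set `T` divides exactly once have density
`∏ (1 - 1/p + 1/p²) ≤ exp (-½ ∑ 1/p)`, and `∑ 1/p` over the class `-1` diverges. The latter is
Dirichlet's theorem in its quantitative form, deduced in
`not_summable_one_div_prime_residueClass` from the pole at `s = 1` of the corresponding `L`-series.

*Theta series.* Everything comes from Jacobi's triple product (`hasSum_tripleProduct`), the limit of
a finite identity between Laurent polynomials with Gaussian binomial coefficients. Specializing
`ζ` gives the expansions of `η(24 m z)` (`hasSum_eta`, exponents `m (6 k + 1)²`) and of
`η(48 z)² / η(24 z)` (`hasSum_eta_sq_div`, exponents `3 (2 k + 1)²`); differentiating the finite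
identity at `ζ = -1` gives `η(24 m z)³` (`hasSum_eta_cube`, exponents `3 m (2 k + 1)²`). For
`η(72 z)³ / η(24 z)` (`hasSum_eta_cube_div`), sort the factors of the triple product at `(ζ, q)` by
their exponents modulo 3, which yields three triple products in `q³`, and compare the terms free of
`ζ`: the result is a sum over `k₀ + k₁ + k₂ = 0` of `q` to a quadratic polynomial.

The quotients at hand are `η(24 c z)² = η · η` and `η(24 c z)⁴ = η · η³` for `a = 1`,
`η(48 z)² / η(24 z)` times `η(48 c z)` or `η(48 c z)³` for `a = 2`, and `η(72 z)³ / η(24 z)` for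
`a = b = 3`.
-/

open Filter Topology

/-! ### Density of the values of a binary quadratic form -/

open ArithmeticFunction.vonMangoldt in
/-- If `∑ 1/p` over the residue class converged, then `log p ≤ p ^ (x - 1) / (x - 1)` would bound the
tail of `∑ log p / p ^ x` by an arbitrarily small multiple of `1 / (x - 1)`, contradicting the lower
bound `1 / (φ(q) (x - 1)) - C` as `x` tends to `1`. -/
theorem not_summable_one_div_prime_residueClass {q : ℕ} [NeZero q] {a : ZMod q} (ha : IsUnit a) :
    ¬ Summable (fun n : ℕ ↦ if n.Prime ∧ (n : ZMod q) = a then (1 : ℝ) / n else 0) := by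
  intro H
  set g : ℕ → ℝ := fun n ↦ if n.Prime ∧ (n : ZMod q) = a then (1 : ℝ) / n else 0 with hg
  have hg0 : ∀ n, 0 ≤ g n := fun n ↦ by simp only [hg]; split_ifs <;> positivity
  have hφ : 0 < (q.totient : ℝ)⁻¹ := inv_pos.mpr (mod_cast q.totient.pos_of_neZero)
  set φ := (q.totient : ℝ)⁻¹
  obtain ⟨C, hC⟩ := LSeries_residueClass_lower_bound ha
  obtain ⟨s, hs⟩ : ∃ s : Finset ℕ, ∑' n, g n - φ / 2 < ∑ n ∈ s, g n := by
    have := H.hasSum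
    rw [HasSum, SummationFilter.unconditional_filter] at this
    exact (this.eventually
      (lt_mem_nhds (show ∑' n, g n - φ / 2 < ∑' n, g n by linarith))).exists
  set h0 : ℕ → ℝ := fun n ↦ (if n.Prime then 0 else residueClass a n) / n with hh0
  have S0 : Summable h0 := summable_residueClass_non_primes_div a
  set h1 : ℕ → ℝ := fun n ↦ if n ∈ s then g n * Real.log n else 0 with hh1
  have S1 : HasSum h1 (∑ n ∈ s, g n * Real.log n) := by
    have := hasSum_sum_of_ne_finset_zero (L := .unconditional ℕ) (f := h1) (s := s)
      (fun b hb ↦ by simp [hh1, hb])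
    rwa [Finset.sum_congr rfl (fun n hn ↦ show h1 n = g n * Real.log n by simp [hh1, hn])] at this
  set h2 : ℕ → ℝ := fun n ↦ if n ∈ s then 0 else g n with hh2
  have S2 : HasSum h2 (∑' n, g n - ∑ n ∈ s, g n) := by
    have e : h2 = fun n ↦ g n - (if n ∈ s then g n else 0) := by
      funext n; by_cases hn : n ∈ s <;> simp [hh2, hn]
    rw [e]
    refine H.hasSum.sub ?_
    have := hasSum_sum_of_ne_finset_zero (L := .unconditional ℕ)
      (f := fun n ↦ if n ∈ s then g n else 0) (s := s) (fun b hb ↦ by simp [hb])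
    rwa [Finset.sum_congr rfl (fun n hn ↦ show (if n ∈ s then g n else 0) = g n by simp [hn])]
      at this
  have key : ∀ x : ℝ, x ∈ Set.Ioc (1 : ℝ) 2 →
      φ / (x - 1) - C ≤ ∑' n, h0 n + ∑ n ∈ s, g n * Real.log n + φ / 2 / (x - 1) := by
    intro x hx
    have hx0 : 0 < x - 1 := by linarith [hx.1]
    refine (hC hx).trans ?_
    have S3 := (S0.hasSum.add S1).add (S2.mul_left (x - 1)⁻¹)
    -- Nonprimes are bounded by `h0`, the primes in `s` by `h1`, all other primes by `h2`.
    have hle : ∀ n, residueClass a n / (n : ℝ) ^ x ≤ h0 n + h1 n + (x - 1)⁻¹ * h2 n := by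
      intro n
      rcases n.eq_zero_or_pos with rfl | hn
      · simp [hh0, hh1, hh2, hg]
      have hn1 : (1 : ℝ) ≤ n := by exact_mod_cast hn
      have hnx : (n : ℝ) ≤ (n : ℝ) ^ x := by
        conv_lhs => rw [← Real.rpow_one n]
        exact Real.rpow_le_rpow_of_exponent_le hn1 hx.1.le
      have hh1n : 0 ≤ h1 n := by
        simp only [hh1]; split_ifs
        · exact mul_nonneg (hg0 n) (Real.log_nonneg hn1)
        · exact le_rfl
      have hh2n : 0 ≤ h2 n := by
        simp only [hh2]; split_ifs
        · exact le_rfl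
        · exact hg0 n
      by_cases hp : n.Prime
      · by_cases hc : (n : ZMod q) = a
        · have hr : residueClass a n = Real.log n := by
            simp [residueClass, hc, ArithmeticFunction.vonMangoldt_apply_prime hp]
          rw [hr]
          have hgn : g n = 1 / n := by simp [hg, hp, hc]
          have hh0n : h0 n = 0 := by simp [hh0, hp]
          by_cases hns : n ∈ s
          · simp only [hh1, hh2, hns, if_true, hgn, hh0n, zero_add, mul_zero, add_zero]
            rw [one_div_mul_eq_div]
            exact div_le_div_of_nonneg_left (Real.log_nonneg hn1) (by linarith) hnx
          · simp only [hh1, hh2, hns, if_false, hgn, hh0n, zero_add]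
            have := Real.log_le_rpow_div (x := n) (by linarith) hx0
            rw [div_le_iff₀ (by linarith)]
            refine this.trans (le_of_eq ?_)
            rw [Real.rpow_sub (by linarith), Real.rpow_one]
            field_simp
        · have hr : residueClass a n = 0 := by simp [residueClass, hc]
          have hh0n : h0 n = 0 := by simp [hh0, hp]
          rw [hr, zero_div, hh0n]; positivity
      · have : residueClass a n / (n : ℝ) ^ x ≤ h0 n := by
          simp only [hh0, hp, if_false]
          exact div_le_div_of_nonneg_left (residueClass_nonneg a _) (by linarith) hnx
        have h3 : 0 ≤ (x - 1)⁻¹ * h2 n := by positivity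
        linarith
    have hnn : ∀ n, 0 ≤ residueClass a n / (n : ℝ) ^ x := fun n ↦
      div_nonneg (residueClass_nonneg a _) (by positivity)
    have := (Summable.of_nonneg_of_le hnn hle S3.summable).tsum_le_tsum hle S3.summable
    rw [S3.tsum_eq] at this
    refine this.trans ?_
    have h5 : (x - 1)⁻¹ * (∑' n, g n - ∑ n ∈ s, g n) ≤ φ / 2 / (x - 1) := by
      rw [div_eq_inv_mul _ (x - 1)]
      exact mul_le_mul_of_nonneg_left (by linarith) (by positivity)
    linarith
  -- `key` says that `φ / (2 * (x - 1))` is at most `B`; this fails at an `x` close enough to `1`.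
  set B := ∑' n, h0 n + ∑ n ∈ s, g n * Real.log n + C with hB
  have hB1 : 0 < |B| + φ + 1 := by positivity
  have := key (1 + φ / (2 * (|B| + φ + 1))) ⟨by
    linarith [show 0 < φ / (2 * (|B| + φ + 1)) by positivity], by
    have : φ / (2 * (|B| + φ + 1)) ≤ 1 := by
      rw [div_le_one (by positivity)]; linarith [abs_nonneg B]
    linarith⟩
  rw [add_sub_cancel_left] at this
  have e : φ / (φ / (2 * (|B| + φ + 1))) = 2 * (|B| + φ + 1) := by field_simp
  have e' : φ / 2 / (φ / (2 * (|B| + φ + 1))) = |B| + φ + 1 := by field_simp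
  rw [e, e'] at this
  linarith [le_abs_self B]

/-- At least `p - 1` of the residues modulo `p ^ 2` are divisible by `p` exactly once. -/
theorem card_range_sq_filter_le {p : ℕ} (hp : 0 < p) :
    ((Finset.range (p ^ 2)).filter fun r ↦ ¬ (p ∣ r ∧ r ≠ 0)).card + (p - 1) ≤ p ^ 2 := by
  have h := Finset.card_filter_add_card_filter_not (s := Finset.range (p ^ 2))
    (fun r ↦ p ∣ r ∧ r ≠ 0)
  rw [Finset.card_range] at h
  have h2 : p - 1 ≤ ((Finset.range (p ^ 2)).filter fun r ↦ p ∣ r ∧ r ≠ 0).card := by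
    rw [← Nat.card_Ico 1 p]
    refine Finset.card_le_card_of_injOn (fun j ↦ p * j) ?_ ?_
    · intro j hj
      simp only [Finset.coe_Ico, Set.mem_Ico] at hj
      simp only [Finset.coe_filter, Finset.mem_range, Set.mem_ofPred_eq]
      refine ⟨?_, dvd_mul_right _ _, (Nat.mul_pos hp hj.1).ne'⟩
      rw [sq]; exact Nat.mul_lt_mul_of_pos_left hj.2 hp
    · intro i _ j _ hij
      exact Nat.eq_of_mul_eq_mul_left hp hij
  omega

/-- The bound comes from the injectivity of reduction modulo all `p ^ 2`, `p ∈ T`, on an interval of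
length `∏ p ^ 2`. -/
theorem count_not_exactly_dvd_le (T : Finset ℕ) (hT : ∀ p ∈ T, p.Prime) (m : ℕ) :
    ((Finset.Ico m (m + ∏ p ∈ T, p ^ 2)).filter fun n ↦ ∀ p ∈ T, ¬ (p ∣ n ∧ ¬ p ^ 2 ∣ n)).card ≤
      ∏ p ∈ T, (p ^ 2 - (p - 1)) := by
  have h1 : ∏ p ∈ T, ((Finset.range (p ^ 2)).filter fun r ↦ ¬ (p ∣ r ∧ r ≠ 0)).card ≤
      ∏ p ∈ T, (p ^ 2 - (p - 1)) := by
    refine Finset.prod_le_prod' fun p hp ↦ ?_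
    have := card_range_sq_filter_le (hT p hp).pos
    omega
  refine le_trans ?_ h1
  rw [← Finset.card_pi]
  refine Finset.card_le_card_of_injOn (fun n p _ ↦ n % p ^ 2) ?_ ?_
  · intro n hn
    simp only [Finset.coe_filter, Set.mem_ofPred_eq] at hn
    simp only [Finset.mem_coe, Finset.mem_pi, Finset.mem_filter, Finset.mem_range]
    intro p hp
    have hpp := (hT p hp).pos
    refine ⟨Nat.mod_lt _ (by positivity), fun h ↦ hn.2 p hp ⟨?_, ?_⟩⟩
    · exact (Nat.dvd_mod_iff (dvd_pow_self p two_ne_zero)).1 h.1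
    · intro h3; exact h.2 (Nat.mod_eq_zero_of_dvd h3)
  · intro i hi j hj hij
    simp only [Finset.coe_filter, Set.mem_ofPred_eq, Finset.mem_Ico] at hi hj
    have hd : ∀ p ∈ T, ((p ^ 2 : ℕ) : ℤ) ∣ (i : ℤ) - j := fun p hp ↦
      ((Nat.modEq_iff_dvd (n := p ^ 2)).1 (congrFun (congrFun hij p) hp).symm)
    have hM : ((∏ p ∈ T, p ^ 2 : ℕ) : ℤ) ∣ (i : ℤ) - j := by
      rw [Nat.cast_prod]
      refine Finset.prod_dvd_of_coprime (fun p hp r hr hpr ↦ ?_) hd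
      have : Nat.Coprime (p ^ 2) (r ^ 2) :=
        ((Nat.coprime_primes (hT p hp) (hT r hr)).2 hpr).pow 2 2
      exact Nat.isCoprime_iff_coprime.2 this
    have := Int.eq_zero_of_abs_lt_dvd hM (by rw [abs_lt]; omega)
    omega

theorem card_filter_range_not_exactly_dvd_le (T : Finset ℕ) (hT : ∀ p ∈ T, p.Prime) (N : ℕ) :
    ((Finset.range N).filter fun n ↦ ∀ p ∈ T, ¬ (p ∣ n ∧ ¬ p ^ 2 ∣ n)).card ≤
      (N / (∏ p ∈ T, p ^ 2) + 1) * ∏ p ∈ T, (p ^ 2 - (p - 1)) := by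
  set M := ∏ p ∈ T, p ^ 2 with hM
  have hM0 : 0 < M := Finset.prod_pos fun p hp ↦ pow_pos (hT p hp).pos 2
  have hk : ∀ k : ℕ, ((Finset.range (k * M)).filter fun n ↦ ∀ p ∈ T, ¬ (p ∣ n ∧ ¬ p ^ 2 ∣ n)).card ≤
      k * ∏ p ∈ T, (p ^ 2 - (p - 1)) := by
    intro k
    induction k with
    | zero => simp
    | succ k ih =>
      have e : Finset.range ((k + 1) * M) =
          Finset.range (k * M) ∪ Finset.Ico (k * M) (k * M + M) := by
        ext x; simp only [Finset.mem_range, Finset.mem_union, Finset.mem_Ico, add_mul, one_mul]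
        omega
      rw [e, Finset.filter_union, add_mul, one_mul]
      exact (Finset.card_union_le _ _).trans (add_le_add ih (count_not_exactly_dvd_le T hT _))
  refine le_trans (Finset.card_le_card (Finset.filter_subset_filter _ ?_)) (hk _)
  refine Finset.range_subset_range.2 ?_
  rw [add_mul, one_mul]
  exact (Nat.lt_div_mul_add hM0).le

theorem prod_sq_sub_le (T : Finset ℕ) (hT : ∀ p ∈ T, p.Prime) :
    ((∏ p ∈ T, (p ^ 2 - (p - 1)) : ℕ) : ℝ) ≤
      (∏ p ∈ T, p ^ 2 : ℕ) * Real.exp (-(∑ p ∈ T, (1 : ℝ) / p) / 2) := by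
  rw [neg_div, Finset.sum_div, ← Finset.sum_neg_distrib, Real.exp_sum, Nat.cast_prod, Nat.cast_prod,
    ← Finset.prod_mul_distrib]
  refine Finset.prod_le_prod (fun p _ ↦ by positivity) fun p hp ↦ ?_
  have h2 : (2 : ℝ) ≤ p := by exact_mod_cast (hT p hp).two_le
  have h1 : p - 1 ≤ p ^ 2 := by nlinarith [(hT p hp).pos, Nat.sub_le p 1]
  rw [Nat.cast_sub h1, Nat.cast_sub (hT p hp).one_le]
  push_cast
  have := Real.add_one_le_exp (-(1 / (p : ℝ) / 2))
  have h3 : (p : ℝ) ^ 2 * (-(1 / (p : ℝ) / 2) + 1) ≤ (p : ℝ) ^ 2 * Real.exp (-(1 / (p : ℝ) / 2)) := by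
    gcongr
  refine le_trans ?_ h3
  have : (p : ℝ) ^ 2 * (-(1 / (p : ℝ) / 2) + 1) = p ^ 2 - p / 2 := by field_simp; ring
  rw [this]; linarith

/-- A set of integers none of which is divisible exactly once by a prime of `P` has density zero as
soon as `∑ 1/p` over `P` diverges. -/
theorem card_filter_div_tendsto_zero (P S : Set ℕ) (hP : ∀ p ∈ P, p.Prime)
    (hPs : ¬ Summable (P.indicator fun p : ℕ ↦ (1 : ℝ) / p))
    (hS : ∀ n ∈ S, ∀ p ∈ P, p ∣ n → p ^ 2 ∣ n) :
    Filter.Tendsto (fun N : ℕ ↦ (({n : ℕ | n < N ∧ n ∈ S}.ncard : ℕ) : ℝ) / N)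
      Filter.atTop (nhds 0) := by
  classical
  rw [Metric.tendsto_atTop]
  intro ε hε
  -- Since `∑ 1/p` diverges, a finite subset `T` of `P` makes the density bound less than `ε / 2`.
  obtain ⟨T, hT, hTsum⟩ : ∃ T : Finset ℕ, (∀ p ∈ T, p ∈ P) ∧
      Real.exp (-(∑ p ∈ T, (1 : ℝ) / p) / 2) < ε / 2 := by
    have h0 : ∀ p, 0 ≤ P.indicator (fun p : ℕ ↦ (1 : ℝ) / p) p := fun p ↦
      Set.indicator_nonneg (fun _ _ ↦ by positivity) p
    by_contra! hcon
    refine hPs (summable_of_sum_le (c := -2 * Real.log (ε / 2)) h0 fun u ↦ ?_)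
    have := hcon (u.filter (· ∈ P)) (fun p hp ↦ (Finset.mem_filter.1 hp).2)
    have h3 := Real.log_le_log (by positivity) this
    rw [Real.log_exp, Finset.sum_filter] at h3
    simp only [Set.indicator_apply]
    linarith
  have hTp : ∀ p ∈ T, p.Prime := fun p hp ↦ hP p (hT p hp)
  set M := ∏ p ∈ T, p ^ 2 with hM
  have hM0 : 0 < M := Finset.prod_pos fun p hp ↦ pow_pos (hTp p hp).pos 2
  obtain ⟨N₀, hN₀⟩ := exists_nat_gt (2 * M / ε + M)
  refine ⟨N₀ + 1, fun N hN ↦ ?_⟩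
  have hN1 : (N₀ : ℝ) < N := by exact_mod_cast hN
  have hMr : (0 : ℝ) < M := by exact_mod_cast hM0
  have hNpos : (0 : ℝ) < N := lt_trans (by positivity) (hN₀.trans hN1)
  rw [Real.dist_eq, sub_zero, abs_of_nonneg (by positivity), div_lt_iff₀ hNpos]
  have hc : ({n : ℕ | n < N ∧ n ∈ S}.ncard) ≤ (N / M + 1) * ∏ p ∈ T, (p ^ 2 - (p - 1)) := by
    refine le_trans ?_ (card_filter_range_not_exactly_dvd_le T hTp N)
    rw [← Set.ncard_coe_finset]
    refine Set.ncard_le_ncard ?_ (Finset.finite_toSet _)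
    intro n hn
    simp only [Finset.coe_filter, Finset.mem_range, Set.mem_ofPred_eq]
    exact ⟨hn.1, fun p hp h ↦ h.2 (hS n hn.2 p (hT p hp) h.1)⟩
  have h1 : (((N / M + 1 : ℕ)) : ℝ) ≤ N / M + 1 := by push_cast; gcongr; exact Nat.cast_div_le
  have hc' : (({n : ℕ | n < N ∧ n ∈ S}.ncard : ℕ) : ℝ) ≤
      (N / M + 1) * (M * Real.exp (-(∑ p ∈ T, (1 : ℝ) / p) / 2)) := by
    refine (Nat.cast_le.2 hc).trans ?_
    rw [Nat.cast_mul]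
    exact mul_le_mul h1 (prod_sq_sub_le T hTp) (by positivity) (by positivity)
  refine hc'.trans_lt ?_
  set E := Real.exp (-(∑ p ∈ T, (1 : ℝ) / p) / 2)
  have e1 : ((N : ℝ) / M + 1) * (M * E) = (N + M) * E := by field_simp
  have hMN : (M : ℝ) < N := lt_trans (by linarith [show 0 < 2 * (M : ℝ) / ε by positivity]) hN1
  rw [e1]
  calc ((N : ℝ) + M) * E < (N + M) * (ε / 2) := by gcongr
    _ < ε * N := by nlinarith

/-- Coefficients supported on a set of density zero are lacunary; the density of `S` is taken along
the integers, that in `LacunaryCoeffs` along the reals. -/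
theorem lacunaryCoeffs_of_tendsto {A : ℕ → ℂ} {S : Set ℕ} (hA : ∀ n, A n ≠ 0 → n ∈ S)
    (hS : Filter.Tendsto (fun N : ℕ ↦ (({n : ℕ | n < N ∧ n ∈ S}.ncard : ℕ) : ℝ) / N)
      Filter.atTop (nhds 0)) : LacunaryCoeffs A := by
  have h1 : Filter.Tendsto (fun x : ℝ ↦ ((⌈x⌉₊ : ℕ) : ℝ) / x) Filter.atTop (nhds 1) :=
    tendsto_nat_ceil_div_atTop
  have h2 := (hS.comp (tendsto_nat_ceil_atTop (α := ℝ))).mul h1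
  have h3 := h1.sub h2
  rw [zero_mul, sub_zero] at h3
  refine tendsto_of_tendsto_of_tendsto_of_le_of_le' h3 h1 ?_ ?_
  · filter_upwards [Filter.eventually_gt_atTop 0] with x hx
    have hN : (0 : ℝ) < (⌈x⌉₊ : ℕ) := by exact_mod_cast Nat.ceil_pos.2 hx
    simp only [Function.comp_apply]
    rw [div_mul_div_cancel₀ hN.ne', ← sub_div]
    gcongr
    rw [sub_le_iff_le_add]
    have : ⌈x⌉₊ ≤ {n : ℕ | (n : ℝ) < x ∧ A n = 0}.ncard + {n : ℕ | n < ⌈x⌉₊ ∧ n ∈ S}.ncard := by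
      refine le_trans ?_ (Set.ncard_union_le _ _)
      have hr : ⌈x⌉₊ = (Finset.range ⌈x⌉₊ : Set ℕ).ncard := by simp
      conv_lhs => rw [hr]
      refine Set.ncard_le_ncard ?_ (Set.Finite.union ?_ ?_)
      · intro n hn
        rw [Finset.coe_range, Set.mem_Iio] at hn
        by_cases h : A n = 0
        · exact Or.inl ⟨Nat.lt_ceil.1 hn, h⟩
        · exact Or.inr ⟨hn, hA n h⟩
      · exact (Set.finite_Iio ⌈x⌉₊).subset fun n hn ↦ Nat.lt_ceil.2 hn.1
      · exact (Set.finite_Iio ⌈x⌉₊).subset fun n hn ↦ hn.1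
    exact_mod_cast this
  · filter_upwards [Filter.eventually_gt_atTop 0] with x hx
    gcongr
    rw [← Finset.card_range ⌈x⌉₊, ← Set.ncard_coe_finset]
    refine Set.ncard_le_ncard ?_ (Finset.finite_toSet _)
    intro n hn
    rw [Finset.coe_range, Set.mem_Iio]
    exact Nat.lt_ceil.2 hn.1

theorem jacobiSym_neg_eq_neg_one {D p : ℕ} (hD : 0 < D) (hp : p % (4 * D) = 4 * D - 1) :
    jacobiSym (-D) p = -1 := by
  have hodd : Odd p := by
    rw [Nat.odd_iff]
    have : p % (4 * D) % 2 = p % 2 := Nat.mod_mod_of_dvd p ⟨2 * D, by ring⟩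
    omega
  rw [jacobiSym.mod_right _ hodd, Int.natAbs_neg, Int.natAbs_natCast, hp]
  have hodd' : Odd (4 * D - 1) := by rw [Nat.odd_iff]; omega
  have h4 : (4 * D - 1) % 4 = 3 := by omega
  have h1 : jacobiSym (4 * D : ℤ) (4 * D - 1) = 1 := by
    rw [show (4 * D : ℤ) = 1 + ((4 * D - 1 : ℕ) : ℤ) by push_cast [Nat.cast_sub (show 1 ≤ 4 * D by omega)]; ring,
      jacobiSym.mod_left, Int.add_emod_right, ← jacobiSym.mod_left, jacobiSym.one_left]
  -- Hence `D` has symbol `1`, while `-1` has symbol `-1` because `4 * D - 1 ≡ 3` modulo `4`.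
  rw [jacobiSym.mul_left, jacobiSym.at_four hodd', one_mul] at h1
  rw [jacobiSym.neg _ hodd', h1, mul_one]
  exact ZMod.χ₄_nat_three_mod_four h4

theorem sq_dvd_of_dvd_of_eq {D K p n : ℕ} (hp : p.Prime) (hD : 0 < D)
    (hpD : p % (4 * D) = 4 * D - 1) (hpK : ¬ p ∣ K) {u v : ℤ} (h : (K : ℤ) * n = u ^ 2 + D * v ^ 2)
    (hn : p ∣ n) : p ^ 2 ∣ n := by
  have := Fact.mk hp
  have hdvd : (p : ℤ) ∣ u ^ 2 + D * v ^ 2 := h ▸ Dvd.dvd.mul_left (by exact_mod_cast hn) _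
  obtain ⟨hu, hv⟩ := jacobiSym.prime_dvd_of_eq_neg_one
    (jacobiSym_neg_eq_neg_one hD hpD) (x := u) (y := v)
    (by simpa [sub_neg_eq_add] using hdvd)
  have h2 : ((p ^ 2 : ℕ) : ℤ) ∣ ((K * n : ℕ) : ℤ) := by
    push_cast
    rw [h]
    exact dvd_add (pow_dvd_pow_of_dvd hu 2) (Dvd.dvd.mul_left (pow_dvd_pow_of_dvd hv 2) _)
  exact (Nat.Coprime.pow_left 2 ((Nat.Prime.coprime_iff_not_dvd hp).2 hpK)).dvd_of_dvd_mul_left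
    (Int.natCast_dvd_natCast.1 h2)

/-- The integers `n` such that `K n` is represented by `u ^ 2 + D v ^ 2` have density zero. -/
theorem tendsto_quadForm {D K : ℕ} (hD : 0 < D) (hK : 0 < K) :
    Filter.Tendsto (fun N : ℕ ↦ (({n : ℕ | n < N ∧
        n ∈ {n : ℕ | ∃ u v : ℤ, (K : ℤ) * n = u ^ 2 + D * v ^ 2}}.ncard : ℕ) : ℝ) / N)
      Filter.atTop (nhds 0) := by
  have : NeZero (4 * D) := ⟨by omega⟩
  have key : ∀ p : ℕ, (p : ZMod (4 * D)) = -1 → p % (4 * D) = 4 * D - 1 := by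
    intro p hp
    have : (p : ZMod (4 * D)) = ((4 * D - 1 : ℕ) : ZMod (4 * D)) := by
      rw [hp, Nat.cast_sub (by omega), ZMod.natCast_self]; simp
    rw [ZMod.natCast_eq_natCast_iff'] at this
    rw [this, Nat.mod_eq_of_lt (by omega)]
  refine card_filter_div_tendsto_zero
    {p : ℕ | (p.Prime ∧ (p : ZMod (4 * D)) = -1) ∧ ¬ p ∣ K} _ (fun p hp ↦ hp.1.1) ?_ ?_
  · intro hs
    refine not_summable_one_div_prime_residueClass (q := 4 * D) (a := -1) isUnit_one.neg ?_
    -- discarding the finitely many primes dividing `K` does not affect convergence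
    refine (summable_congr_cofinite ?_).1 hs
    have hfin : {p : ℕ | p ∣ K}.Finite := (Set.finite_Iic K).subset fun p hp ↦ Nat.le_of_dvd hK hp
    filter_upwards [hfin.compl_mem_cofinite] with p hp
    simp only [Set.mem_compl_iff, Set.mem_ofPred_eq] at hp
    simp [Set.indicator_apply, hp]
  · rintro n ⟨u, v, h⟩ p hp hpn
    exact sq_dvd_of_dvd_of_eq hp.1.1 hD (key p hp.1.2) hp.2 h hpn

/-! ### Jacobi's triple product and the cube of Euler's product -/

/-- The `k`-th triangular number `k (k + 1) / 2`, for an integer `k`. -/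
def triangular (k : ℤ) : ℤ := k * (k + 1) / 2

theorem two_mul_triangular (k : ℤ) : 2 * triangular k = k * (k + 1) :=
  Int.mul_ediv_cancel' (Int.even_mul_succ_self k).two_dvd

theorem triangular_sub_one (k : ℤ) : triangular (k - 1) = triangular k - k := by
  have h1 := two_mul_triangular (k - 1)
  have h2 := two_mul_triangular k
  linarith

theorem triangular_add_one (k : ℤ) : triangular (k + 1) = triangular k + (k + 1) := by
  have h1 := two_mul_triangular (k + 1)
  have h2 := two_mul_triangular k
  linarith

/-- The finite product `(q; q)_N = ∏_{n = 1}^N (1 - q ^ n)`. -/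
def eulerProd (q : ℂ) (N : ℕ) : ℂ := ∏ i ∈ Finset.range N, (1 - q ^ (i + 1))

/-- Euler's product `(q; q)_∞ = ∏_{n ≥ 1} (1 - q ^ n)`. -/
noncomputable def eulerFun (q : ℂ) : ℂ := ∏' i : ℕ, (1 - q ^ (i + 1))

/-- `1 / (q; q)_m`, extended by `0` to negative integers `m`. -/
noncomputable def invEulerProd (q : ℂ) (m : ℤ) : ℂ := if 0 ≤ m then (eulerProd q m.toNat)⁻¹ else 0

section

variable {q : ℂ}

theorem one_sub_pow_ne_zero (hq : ‖q‖ < 1) (n : ℕ) : 1 - q ^ (n + 1) ≠ 0 := by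
  intro h
  have h1 : ‖q ^ (n + 1)‖ = 1 := by rw [← sub_eq_zero.1 h, norm_one]
  rw [norm_pow] at h1
  exact (pow_lt_one₀ (norm_nonneg _) hq n.succ_ne_zero).ne h1

theorem eulerFun_ne_zero (hq : ‖q‖ < 1) : eulerFun q ≠ 0 := by
  have := tprod_one_add_ne_zero_of_summable (f := fun n : ℕ ↦ -q ^ (n + 1))
    (fun i ↦ by simpa [← sub_eq_add_neg] using one_sub_pow_ne_zero hq i)
    (by simpa using (summable_nat_add_iff 1).mpr (summable_geometric_of_lt_one (norm_nonneg _) hq))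
  simpa [eulerFun, sub_eq_add_neg] using this

theorem tendsto_eulerProd (hq : ‖q‖ < 1) : Tendsto (eulerProd q) atTop (𝓝 (eulerFun q)) :=
  (ModularForm.multipliable_one_sub_pow hq).hasProd.tendsto_prod_nat

/-- Thanks to the extension by zero, the recurrence needs no condition on the integer `m`; at `m = 0`
both sides vanish. -/
theorem invEulerProd_sub_one (hq : ‖q‖ < 1) (m : ℤ) :
    invEulerProd q (m - 1) = (1 - q ^ m) * invEulerProd q m := by
  unfold invEulerProd
  rcases lt_trichotomy m 0 with h | rfl | h
  · rw [if_neg (by omega), if_neg (by omega), mul_zero]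
  · simp
  · obtain ⟨n, rfl⟩ : ∃ n : ℕ, m = n + 1 := ⟨(m - 1).toNat, by omega⟩
    rw [if_pos (by omega), if_pos (by omega), add_sub_cancel_right, Int.toNat_natCast,
      show ((n : ℤ) + 1).toNat = n + 1 by omega, eulerProd, eulerProd, Finset.prod_range_succ,
      show q ^ ((n : ℤ) + 1) = q ^ (n + 1) by exact_mod_cast zpow_natCast q (n + 1)]
    have := one_sub_pow_ne_zero hq n
    rw [mul_inv, mul_comm, mul_assoc, inv_mul_cancel₀ this, mul_one]

/-- The Gaussian binomial coefficient `[2 N, N + k]_q`, which is `0` unless `-N ≤ k ≤ N`. -/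
noncomputable def centralGaussBinom (q : ℂ) (N : ℕ) (k : ℤ) : ℂ :=
  eulerProd q (2 * N) * invEulerProd q (N + k) * invEulerProd q (N - k)

theorem centralGaussBinom_eq_zero {N : ℕ} {k : ℤ} (hk : k ∉ Finset.Icc (-(N : ℤ)) N) :
    centralGaussBinom q N k = 0 := by
  rw [Finset.mem_Icc, not_and_or] at hk
  unfold centralGaussBinom invEulerProd
  rcases hk with h | h
  · rw [if_neg (by omega)]; simp
  · rw [if_neg (show ¬ (0 : ℤ) ≤ N - k by omega)]; simp

/-- The recurrence in `N` that corresponds to multiplying the finite triple product by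
`(1 + ζ q ^ (N + 1)) (1 + ζ⁻¹ q ^ N)`. -/
theorem centralGaussBinom_succ (hq : ‖q‖ < 1) (hq0 : q ≠ 0) (N : ℕ) (k : ℤ) :
    centralGaussBinom q (N + 1) k = (1 + q ^ (2 * N + 1)) * centralGaussBinom q N k +
      q ^ ((N : ℤ) + 1 - k) * centralGaussBinom q N (k - 1) +
      q ^ ((N : ℤ) + 1 + k) * centralGaussBinom q N (k + 1) := by
  unfold centralGaussBinom
  have a1 := invEulerProd_sub_one hq (N + 1 + k)
  have a2 := invEulerProd_sub_one hq (N + 1 - k)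
  have a3 := invEulerProd_sub_one hq (N + k)
  have a4 := invEulerProd_sub_one hq (N - k)
  rw [show (N : ℤ) + 1 + k - 1 = N + k by ring] at a1
  rw [show (N : ℤ) + 1 - k - 1 = N - k by ring] at a2
  have e1 : q ^ ((N : ℤ) + k) = q ^ ((N : ℤ) + 1 + k) * q⁻¹ := by
    rw [← zpow_neg_one, ← zpow_add₀ hq0]; congr 1; ring
  have e2 : q ^ ((N : ℤ) - k) = q ^ ((N : ℤ) + 1 - k) * q⁻¹ := by
    rw [← zpow_neg_one, ← zpow_add₀ hq0]; congr 1; ring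
  have e3 : q ^ (2 * N + 1 + 1) = q ^ ((N : ℤ) + 1 + k) * q ^ ((N : ℤ) + 1 - k) := by
    rw [← zpow_natCast, ← zpow_add₀ hq0]; congr 1; push_cast; ring
  have e4 : q ^ (2 * N + 1) = q ^ ((N : ℤ) + 1 + k) * q ^ ((N : ℤ) + 1 - k) * q⁻¹ := by
    rw [← e3, pow_succ _ (2 * N + 1), mul_assoc, mul_inv_cancel₀ hq0, mul_one]
  have e5 : eulerProd q (2 * (N + 1)) =
      eulerProd q (2 * N) * (1 - q ^ (2 * N + 1)) * (1 - q ^ (2 * N + 1 + 1)) := by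
    rw [show 2 * (N + 1) = 2 * N + 1 + 1 by ring, eulerProd, Finset.prod_range_succ,
      Finset.prod_range_succ, eulerProd]
  rw [e5, show (N : ℤ) + (k - 1) = N + k - 1 by ring, show (N : ℤ) - (k - 1) = N + 1 - k by ring,
    show (N : ℤ) + (k + 1) = N + 1 + k by ring, show (N : ℤ) - (k + 1) = N - k - 1 by ring,
    a3, a4, a1, a2, e1, e2, e4, e3]
  push_cast
  generalize q ^ ((N : ℤ) + 1 + k) = A
  generalize q ^ ((N : ℤ) + 1 - k) = B
  ring

/-- The finite form of the triple product identity, proved by induction on `N`. The sum has only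
finitely many nonzero terms. -/
theorem hasSum_finite_tripleProduct (hq : ‖q‖ < 1) (hq0 : q ≠ 0) {ζ : ℂ} (hζ : ζ ≠ 0) (N : ℕ) :
    HasSum (fun k : ℤ ↦ centralGaussBinom q N k * (ζ ^ k * q ^ triangular k))
      (∏ j ∈ Finset.range N, ((1 + ζ * q ^ (j + 1)) * (1 + ζ⁻¹ * q ^ j))) := by
  induction N with
  | zero =>
    rw [Finset.prod_range_zero]
    have h1 : centralGaussBinom q 0 0 * (ζ ^ (0 : ℤ) * q ^ triangular 0) = 1 := by
      simp [centralGaussBinom, invEulerProd, eulerProd, triangular]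
    rw [← h1]
    refine hasSum_single 0 fun k hk ↦ ?_
    rw [centralGaussBinom_eq_zero (by simpa using hk), zero_mul]
  | succ N ih =>
    have h1 := ih.mul_left (1 + q ^ (2 * N + 1))
    have h2 := (((Equiv.subRight (1 : ℤ)).hasSum_iff).2 ih).mul_left (ζ * q ^ (N + 1))
    have h3 := (((Equiv.addRight (1 : ℤ)).hasSum_iff).2 ih).mul_left (ζ⁻¹ * q ^ N)
    have h := (h1.add h2).add h3
    rw [Finset.prod_range_succ]
    convert! h using 1
    · funext k
      simp only [Function.comp_apply, Equiv.subRight_apply, Equiv.coe_addRight]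
      rw [centralGaussBinom_succ hq hq0, triangular_sub_one, triangular_add_one]
      have e1 : ζ * q ^ (N + 1) * (centralGaussBinom q N (k - 1) *
          (ζ ^ (k - 1) * q ^ (triangular k - k))) = q ^ ((N : ℤ) + 1 - k) *
            centralGaussBinom q N (k - 1) * (ζ ^ k * q ^ triangular k) := by
        rw [zpow_sub_one₀ hζ, zpow_sub₀ hq0, zpow_sub₀ hq0, zpow_add_one₀ hq0, zpow_natCast]
        field_simp
        ring
      have e2 : ζ⁻¹ * q ^ N * (centralGaussBinom q N (k + 1) *
          (ζ ^ (k + 1) * q ^ (triangular k + (k + 1)))) = q ^ ((N : ℤ) + 1 + k) *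
            centralGaussBinom q N (k + 1) * (ζ ^ k * q ^ triangular k) := by
        simp only [zpow_add₀ hζ, zpow_add₀ hq0, zpow_one, zpow_natCast]
        field_simp
      rw [e1, e2]
      ring
    · field_simp
      ring

theorem tendsto_invEulerProd (hq : ‖q‖ < 1) {f : ℕ → ℤ} (hf : Tendsto f atTop atTop) :
    Tendsto (fun N ↦ invEulerProd q (f N)) atTop (𝓝 (eulerFun q)⁻¹) := by
  have h2 : Tendsto (fun N ↦ (f N).toNat) atTop atTop := by
    refine tendsto_atTop.2 fun b ↦ ?_
    filter_upwards [hf.eventually_ge_atTop (b : ℤ)] with N hN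
    omega
  refine (((tendsto_eulerProd hq).comp h2).inv₀ (eulerFun_ne_zero hq)).congr' ?_
  filter_upwards [hf.eventually_ge_atTop 0] with N hN
  simp [invEulerProd, hN]

theorem tendsto_centralGaussBinom (hq : ‖q‖ < 1) (k : ℤ) :
    Tendsto (fun N ↦ centralGaussBinom q N k) atTop (𝓝 (eulerFun q)⁻¹) := by
  have h0 : Tendsto (fun N : ℕ ↦ 2 * N) atTop atTop :=
    tendsto_id.const_mul_atTop' two_pos
  have h1 : Tendsto (fun N : ℕ ↦ (N : ℤ) + k) atTop atTop :=
    tendsto_atTop_add_const_right _ _ tendsto_natCast_atTop_atTop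
  have h2 : Tendsto (fun N : ℕ ↦ (N : ℤ) - k) atTop atTop :=
    tendsto_atTop_add_const_right _ _ tendsto_natCast_atTop_atTop
  have := (((tendsto_eulerProd hq).comp h0).mul (tendsto_invEulerProd hq h1)).mul
    (tendsto_invEulerProd hq h2)
  rwa [mul_inv_cancel₀ (eulerFun_ne_zero hq), one_mul] at this

/-- A bound uniform in `N` and `k`, as dominated convergence requires. -/
theorem exists_norm_centralGaussBinom_le (hq : ‖q‖ < 1) :
    ∃ C, ∀ N k, ‖centralGaussBinom q N k‖ ≤ C := by
  obtain ⟨A, hA⟩ := (tendsto_eulerProd hq).norm.bddAbove_range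
  obtain ⟨B, hB⟩ := ((tendsto_eulerProd hq).inv₀ (eulerFun_ne_zero hq)).norm.bddAbove_range
  have hA' : ∀ N, ‖eulerProd q N‖ ≤ A := fun N ↦ hA ⟨N, rfl⟩
  have hB0 : 0 ≤ B := (norm_nonneg _).trans (hB ⟨0, rfl⟩)
  have hB' : ∀ m, ‖invEulerProd q m‖ ≤ B := fun m ↦ by
    unfold invEulerProd
    split_ifs
    · exact hB ⟨m.toNat, rfl⟩
    · simpa using hB0
  refine ⟨A * B * B, fun N k ↦ ?_⟩
  rw [centralGaussBinom, norm_mul, norm_mul]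
  have hA0 : 0 ≤ A := (norm_nonneg _).trans (hA' 0)
  gcongr
  exacts [hA' _, hB' _, hB' _]

/-- Summability by comparison with the majorant of the two-variable Jacobi theta series; the factor
`|k| ^ m` serves the differentiated series. -/
theorem summable_pow_mul_norm_theta (hq : ‖q‖ < 1) (hq0 : q ≠ 0) {ζ : ℂ} (hζ : ζ ≠ 0) (m : ℕ) :
    Summable fun k : ℤ ↦ (|k| : ℝ) ^ m * ‖ζ ^ k * q ^ triangular k‖ := by
  have hlq : Real.log ‖q‖ < 0 := Real.log_neg (norm_pos_iff.2 hq0) hq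
  set S : ℝ := |Real.log ‖ζ‖ + Real.log ‖q‖ / 2| / (2 * Real.pi) with hS
  set T : ℝ := -Real.log ‖q‖ / (2 * Real.pi) with hT
  have hT0 : 0 < T := div_pos (by linarith) (by positivity)
  refine (summable_pow_mul_jacobiTheta₂_term_bound S hT0 m).of_nonneg_of_le
    (fun k ↦ by positivity) fun k ↦ ?_
  rw [Int.cast_abs]
  gcongr
  have ht : (triangular k : ℝ) = (k * (k + 1)) / 2 := by
    have := two_mul_triangular k
    have h2 : (2 : ℝ) * triangular k = k * (k + 1) := by exact_mod_cast this
    linarith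
  rw [norm_mul, norm_zpow, norm_zpow, ← Real.rpow_intCast, ← Real.rpow_intCast,
    Real.rpow_def_of_pos (norm_pos_iff.2 hζ), Real.rpow_def_of_pos (norm_pos_iff.2 hq0),
    ← Real.exp_add, Real.exp_le_exp, ht]
  have e : -Real.pi * (T * k ^ 2 - 2 * S * |(k : ℝ)|) =
      Real.log ‖q‖ * k ^ 2 / 2 + |Real.log ‖ζ‖ + Real.log ‖q‖ / 2| * |(k : ℝ)| := by
    rw [hS, hT]; field_simp; ring
  rw [e, ← abs_mul]
  have := le_abs_self ((Real.log ‖ζ‖ + Real.log ‖q‖ / 2) * k)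
  linarith

theorem summable_theta (hq : ‖q‖ < 1) (hq0 : q ≠ 0) {ζ : ℂ} (hζ : ζ ≠ 0) :
    Summable fun k : ℤ ↦ ζ ^ k * q ^ triangular k :=
  .of_norm (by simpa using summable_pow_mul_norm_theta hq hq0 hζ 0)

/-- The product `∏_{n ≥ 1} (1 + ζ q ^ n) (1 + ζ⁻¹ q ^ (n - 1))`. -/
noncomputable def thetaProd (ζ q : ℂ) : ℂ := ∏' j : ℕ, ((1 + ζ * q ^ (j + 1)) * (1 + ζ⁻¹ * q ^ j))

theorem multipliable_one_add_mul_pow (hq : ‖q‖ < 1) (ζ : ℂ) :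
    Multipliable fun j : ℕ ↦ 1 + ζ * q ^ j := by
  refine multipliable_one_add_of_summable ?_
  simpa using (summable_geometric_of_lt_one (norm_nonneg _) hq).mul_left ‖ζ‖

theorem multipliable_thetaProd (hq : ‖q‖ < 1) (ζ : ℂ) :
    Multipliable fun j : ℕ ↦ (1 + ζ * q ^ (j + 1)) * (1 + ζ⁻¹ * q ^ j) := by
  refine .mul ?_ (multipliable_one_add_mul_pow hq _)
  simpa [pow_succ', mul_assoc] using multipliable_one_add_mul_pow hq (ζ * q)

/-- **Jacobi's triple product identity**. -/
theorem hasSum_tripleProduct (hq : ‖q‖ < 1) (hq0 : q ≠ 0) {ζ : ℂ} (hζ : ζ ≠ 0) :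
    HasSum (fun k : ℤ ↦ ζ ^ k * q ^ triangular k) (eulerFun q * thetaProd ζ q) := by
  have hs := summable_theta hq hq0 hζ
  obtain ⟨C, hC⟩ := exists_norm_centralGaussBinom_le hq
  have h1 := tendsto_tsum_of_dominated_convergence (𝓕 := atTop)
    (f := fun N k ↦ centralGaussBinom q N k * (ζ ^ k * q ^ triangular k))
    (g := fun k ↦ (eulerFun q)⁻¹ * (ζ ^ k * q ^ triangular k)) (hs.norm.mul_left C)
    (fun k ↦ (tendsto_centralGaussBinom hq k).mul_const _)
    (.of_forall fun N k ↦ by rw [norm_mul]; exact mul_le_mul_of_nonneg_right (hC N k) (norm_nonneg _))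
  simp_rw [(hasSum_finite_tripleProduct hq hq0 hζ _).tsum_eq] at h1
  have h2 := tendsto_nhds_unique h1 (multipliable_thetaProd hq ζ).hasProd.tendsto_prod_nat
  rw [tsum_mul_left, inv_mul_eq_iff_eq_mul₀ (eulerFun_ne_zero hq)] at h2
  rw [thetaProd, ← h2]
  exact hs.hasSum

/-- The derivative at `ζ = -1` of the finite triple product identity. -/
theorem hasSum_finite_cube (hq : ‖q‖ < 1) (hq0 : q ≠ 0) (N : ℕ) :
    HasSum (fun k : ℤ ↦ centralGaussBinom q (N + 1) k * ((k * (-1) ^ k) * q ^ triangular k))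
      (eulerProd q (N + 1) * eulerProd q N) := by
  have h0 : (-1 : ℂ) ≠ 0 := by norm_num
  set s := Finset.Icc (-((N + 1 : ℕ) : ℤ)) ((N + 1 : ℕ) : ℤ)
  set G : ℂ → ℂ := fun ζ ↦ (∏ j ∈ Finset.range (N + 1), (1 + ζ * q ^ (j + 1))) *
    ∏ j ∈ Finset.range N, (1 + ζ⁻¹ * q ^ (j + 1)) with hG
  have hGd : DifferentiableAt ℂ G (-1) := by
    simp only [hG]
    refine .mul (.fun_finsetProd fun j _ ↦ by fun_prop) (.fun_finsetProd fun j _ ↦ ?_)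
    fun_prop (disch := exact h0)
  have hinv : HasDerivAt (fun ζ : ℂ ↦ 1 + ζ⁻¹) (-1) (-1) := by
    simpa using (hasDerivAt_inv h0).const_add 1
  -- The factor `1 + ζ⁻¹` vanishes at `-1`, so only its own derivative contributes.
  have hL : HasDerivAt (fun ζ ↦ (1 + ζ⁻¹) * G ζ) (-G (-1)) (-1) := by
    convert! hinv.mul hGd.hasDerivAt using 1
    norm_num
  have hR : HasDerivAt (fun ζ : ℂ ↦ ∑ k ∈ s, centralGaussBinom q (N + 1) k *
      (ζ ^ k * q ^ triangular k))
      (∑ k ∈ s, centralGaussBinom q (N + 1) k * ((k * (-1) ^ (k - 1)) * q ^ triangular k)) (-1) :=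
    .fun_sum fun k _ ↦ ((hasDerivAt_zpow k (-1) (Or.inl h0)).mul_const _).const_mul _
  have heq : (fun ζ ↦ (1 + ζ⁻¹) * G ζ) =ᶠ[𝓝 (-1)] fun ζ : ℂ ↦ ∑ k ∈ s,
      centralGaussBinom q (N + 1) k * (ζ ^ k * q ^ triangular k) := by
    filter_upwards [isOpen_ne.mem_nhds h0] with ζ hζ
    have h1 := hasSum_finite_tripleProduct hq hq0 hζ (N + 1)
    have h2 : HasSum _ (∑ k ∈ s, centralGaussBinom q (N + 1) k * (ζ ^ k * q ^ triangular k)) :=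
      hasSum_sum_of_ne_finset_zero (L := .unconditional ℤ) fun k hk ↦ by
        rw [centralGaussBinom_eq_zero hk, zero_mul]
    rw [← h1.unique h2, Finset.prod_mul_distrib, Finset.prod_range_succ' (fun j ↦ 1 + ζ⁻¹ * q ^ j)]
    simp only [hG]
    ring
  have hd := hL.unique (hR.congr_of_eventuallyEq heq)
  have hG1 : G (-1) = eulerProd q (N + 1) * eulerProd q N := by
    simp [hG, eulerProd, sub_eq_add_neg, inv_neg]
  rw [← hG1, ← neg_neg (G (-1)), hd, ← Finset.sum_neg_distrib]
  rw [Finset.sum_congr rfl (g := fun k ↦ centralGaussBinom q (N + 1) k *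
    ((k * (-1) ^ k) * q ^ triangular k)) fun k _ ↦ by rw [zpow_sub_one₀ h0]; ring]
  exact hasSum_sum_of_ne_finset_zero (L := .unconditional ℤ) fun k hk ↦ by
    rw [centralGaussBinom_eq_zero hk, zero_mul]

/-- **Jacobi's identity** for the cube of Euler's product. Summing over all integers instead of
`k ≥ 0` turns the usual coefficient `2 k + 1` into `k`. -/
theorem hasSum_eulerFun_cube (hq : ‖q‖ < 1) (hq0 : q ≠ 0) :
    HasSum (fun k : ℤ ↦ (k * (-1) ^ k : ℂ) * q ^ triangular k) (eulerFun q ^ 3) := by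
  have hs : Summable fun k : ℤ ↦ ‖(k * (-1) ^ k : ℂ) * q ^ triangular k‖ := by
    refine (summable_pow_mul_norm_theta hq hq0 (ζ := -1) (by norm_num) 1).congr fun k ↦ ?_
    simp [mul_assoc]
  obtain ⟨C, hC⟩ := exists_norm_centralGaussBinom_le hq
  have h1 := tendsto_tsum_of_dominated_convergence (𝓕 := atTop)
    (f := fun N k ↦ centralGaussBinom q (N + 1) k * ((k * (-1) ^ k : ℂ) * q ^ triangular k))
    (g := fun k ↦ (eulerFun q)⁻¹ * ((k * (-1) ^ k : ℂ) * q ^ triangular k)) (hs.mul_left C)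
    (fun k ↦ ((tendsto_add_atTop_iff_nat 1).2 (tendsto_centralGaussBinom hq k)).mul_const _)
    (.of_forall fun N k ↦ by rw [norm_mul]; exact mul_le_mul_of_nonneg_right (hC _ k) (norm_nonneg _))
  simp_rw [(hasSum_finite_cube hq hq0 _).tsum_eq] at h1
  have h2 := tendsto_nhds_unique h1
    (((tendsto_add_atTop_iff_nat 1).2 (tendsto_eulerProd hq)).mul (tendsto_eulerProd hq))
  rw [tsum_mul_left, inv_mul_eq_iff_eq_mul₀ (eulerFun_ne_zero hq)] at h2
  rw [show eulerFun q ^ 3 = eulerFun q * (eulerFun q * eulerFun q) by ring, ← h2]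
  exact hs.of_norm.hasSum

end

/-! ### Further theta series: pentagonal numbers, triangular numbers, 3-cores -/

section

theorem HasSum.mul_complex {α β : Type*} {f : α → ℂ} {g : β → ℂ} {a b : ℂ} (hf : HasSum f a)
    (hg : HasSum g b) : HasSum (fun x : α × β ↦ f x.1 * g x.2) (a * b) :=
  hf.mul hg (summable_mul_of_summable_norm hf.summable.norm hg.summable.norm)

/-- Grouping the factors of an infinite product in threes. -/
theorem tprod_eq_tprod_three_mul {f : ℕ → ℂ} (hf : Multipliable f) {g : ℕ → ℂ}
    (hg : Multipliable g) (h : ∀ m, f (3 * m) * f (3 * m + 1) * f (3 * m + 2) = g m) :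
    ∏' n, f n = ∏' m, g m := by
  have h3 : Tendsto (fun N : ℕ ↦ 3 * N) atTop atTop := tendsto_id.const_mul_atTop' (by norm_num)
  refine tendsto_nhds_unique ((hf.hasProd.tendsto_prod_nat).comp h3)
    (hg.hasProd.tendsto_prod_nat.congr fun N ↦ ?_)
  simp only [Function.comp_apply]
  induction N with
  | zero => simp
  | succ N ih =>
    rw [Finset.prod_range_succ, ih, ← h, show 3 * (N + 1) = 3 * N + 1 + 1 + 1 by ring,
      Finset.prod_range_succ, Finset.prod_range_succ, Finset.prod_range_succ]
    ring

/-- Integrating over the unit circle picks out the terms that do not involve `ζ`. -/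
theorem hasSum_constantTerm {ι : Type*} [Countable ι] {w : ι → ℂ} (hw : Summable w) (n : ι → ℤ)
    {F : ℂ → ℂ} (hF : ∀ ζ : ℂ, ‖ζ‖ = 1 → HasSum (fun i ↦ w i * ζ ^ n i) (F ζ)) :
    HasSum (fun i ↦ if n i = 0 then w i else 0)
      ((2 * Real.pi : ℂ)⁻¹ * ∫ θ in (0 : ℝ)..2 * Real.pi, F (Complex.exp (θ * Complex.I))) := by
  have hpi : (2 * Real.pi : ℂ) ≠ 0 := by exact_mod_cast (by positivity : 2 * Real.pi ≠ 0)
  have hnorm : ∀ θ : ℝ, ‖Complex.exp (θ * Complex.I)‖ = 1 := Complex.norm_exp_ofReal_mul_I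
  have h1 := intervalIntegral.hasSum_integral_of_dominated_convergence (μ := MeasureTheory.volume)
    (a := 0) (b := 2 * Real.pi) (F := fun i (θ : ℝ) ↦ w i * Complex.exp (θ * Complex.I) ^ n i)
    (f := fun θ ↦ F (Complex.exp (θ * Complex.I))) (fun i _ ↦ ‖w i‖)
    (fun i ↦ by
      refine (Continuous.aestronglyMeasurable ?_)
      refine continuous_const.mul (Continuous.zpow₀ (by fun_prop) _ fun _ ↦ Or.inl (Complex.exp_ne_zero _)))
    (fun i ↦ .of_forall fun θ _ ↦ by rw [norm_mul, norm_zpow, hnorm, one_zpow, mul_one])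
    (.of_forall fun _ _ ↦ hw.norm) intervalIntegrable_const
    (.of_forall fun θ _ ↦ hF _ (hnorm θ))
  refine (h1.mul_left ((2 * Real.pi : ℂ)⁻¹)).congr_fun fun i ↦ ?_
  rw [intervalIntegral.integral_const_mul]
  split_ifs with hn
  · simp only [hn, zpow_zero, intervalIntegral.integral_const, sub_zero, Complex.real_smul, mul_one]
    push_cast
    field_simp
  · have h0 : (n i : ℂ) * Complex.I ≠ 0 := mul_ne_zero (by exact_mod_cast hn) Complex.I_ne_zero
    have e : ∀ θ : ℝ, Complex.exp (θ * Complex.I) ^ n i = Complex.exp (n i * Complex.I * θ) :=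
      fun θ ↦ by rw [← Complex.exp_int_mul]; congr 1; ring
    have e2 : Complex.exp (n i * Complex.I * ((2 * Real.pi : ℝ) : ℂ)) = 1 := by
      rw [Complex.exp_eq_one_iff]; exact ⟨n i, by push_cast; ring⟩
    simp_rw [e]
    rw [integral_exp_mul_complex h0, e2]
    simp

end

section

variable {q : ℂ}

/-- The factors of the product, sorted by the exponent of `q` modulo 3. -/
theorem thetaProd_three (hq : ‖q‖ < 1) (hq0 : q ≠ 0) {ζ : ℂ} (hζ : ζ ≠ 0) :
    thetaProd ζ q = thetaProd ζ (q ^ 3) * thetaProd (ζ * q⁻¹) (q ^ 3) *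
      thetaProd (ζ * (q ^ 2)⁻¹) (q ^ 3) := by
  have hq3 : ‖q ^ 3‖ < 1 := by rw [norm_pow]; exact pow_lt_one₀ (norm_nonneg _) hq (by norm_num)
  have m := fun ζ ↦ multipliable_thetaProd hq3 ζ
  unfold thetaProd
  rw [← (m _).tprod_mul (m _), ← ((m _).mul (m _)).tprod_mul (m _)]
  refine tprod_eq_tprod_three_mul (multipliable_thetaProd hq ζ) (((m _).mul (m _)).mul (m _))
    fun m ↦ ?_
  have e1 : ζ * q⁻¹ * (q ^ 3) ^ (m + 1) = ζ * q ^ (3 * m + 1 + 1) := by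
    rw [← pow_mul, mul_add, pow_add]; field_simp; ring
  have e2 : ζ * (q ^ 2)⁻¹ * (q ^ 3) ^ (m + 1) = ζ * q ^ (3 * m + 1) := by
    rw [← pow_mul, mul_add, pow_add]; field_simp; ring
  have e3 : (ζ * q⁻¹)⁻¹ * (q ^ 3) ^ m = ζ⁻¹ * q ^ (3 * m + 1) := by
    rw [← pow_mul, pow_add]; field_simp
  have e4 : (ζ * (q ^ 2)⁻¹)⁻¹ * (q ^ 3) ^ m = ζ⁻¹ * q ^ (3 * m + 2) := by
    rw [← pow_mul, pow_add]; field_simp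
  rw [e1, e2, e3, e4, ← pow_mul, ← pow_mul]
  ring

/-- The factors of Euler's product, sorted by the exponent of `q` modulo 3. -/
theorem eulerFun_three (hq : ‖q‖ < 1) (hq0 : q ≠ 0) :
    eulerFun (q ^ 3) * thetaProd (-q⁻¹) (q ^ 3) = eulerFun q := by
  have hq3 : ‖q ^ 3‖ < 1 := by rw [norm_pow]; exact pow_lt_one₀ (norm_nonneg _) hq (by norm_num)
  have m1 := ModularForm.multipliable_one_sub_pow hq3
  have m2 := multipliable_thetaProd hq3 (-q⁻¹)
  unfold thetaProd eulerFun
  rw [← m1.tprod_mul m2]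
  refine (tprod_eq_tprod_three_mul (ModularForm.multipliable_one_sub_pow hq) (m1.mul m2)
    fun m ↦ ?_).symm
  have e1 : -q⁻¹ * (q ^ 3) ^ (m + 1) = -q ^ (3 * m + 1 + 1) := by
    rw [← pow_mul, mul_add, pow_add]; field_simp; ring
  have e2 : (-q⁻¹)⁻¹ * (q ^ 3) ^ m = -q ^ (3 * m + 1) := by
    rw [← pow_mul, pow_add, inv_neg, inv_inv]; ring
  rw [e1, e2, ← pow_mul]
  ring

/-- At `ζ = 1` the theta product is `2 ∏ (1 + q ^ n) ^ 2`, the factor `2` being `1 + q ^ 0`, and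
`(1 - q ^ n) (1 + q ^ n) = 1 - q ^ (2 n)`. -/
theorem eulerFun_mul_thetaProd_one (hq : ‖q‖ < 1) :
    eulerFun q * (eulerFun q * thetaProd 1 q) = 2 * eulerFun (q ^ 2) ^ 2 := by
  have m1 := ModularForm.multipliable_one_sub_pow hq
  have m2 := multipliable_one_add_mul_pow hq 1
  have m3 : Multipliable fun j : ℕ ↦ 1 + 1 * q ^ (j + 1) := by
    simpa [pow_succ', mul_assoc] using multipliable_one_add_mul_pow hq q
  have h1 : thetaProd 1 q = 2 * (∏' j : ℕ, (1 + 1 * q ^ (j + 1))) ^ 2 := by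
    unfold thetaProd
    rw [inv_one, m3.tprod_mul m2, tprod_eq_zero_mul' (f := fun j : ℕ ↦ 1 + 1 * q ^ j) m3]
    ring
  have h2 : eulerFun (q ^ 2) = eulerFun q * ∏' j : ℕ, (1 + 1 * q ^ (j + 1)) := by
    unfold eulerFun
    rw [← m1.tprod_mul m3]
    refine tprod_congr fun j ↦ ?_
    ring
  rw [h1, h2]
  ring

/-- **Euler's pentagonal number theorem**. -/
theorem hasSum_eulerFun (hq : ‖q‖ < 1) (hq0 : q ≠ 0) :
    HasSum (fun k : ℤ ↦ (-1) ^ k * q ^ (3 * triangular k - k)) (eulerFun q) := by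
  have hq3 : ‖q ^ 3‖ < 1 := by rw [norm_pow]; exact pow_lt_one₀ (norm_nonneg _) hq (by norm_num)
  have h := hasSum_tripleProduct hq3 (pow_ne_zero 3 hq0) (ζ := -q⁻¹)
    (neg_ne_zero.2 (inv_ne_zero hq0))
  rw [eulerFun_three hq hq0] at h
  refine h.congr_fun fun k ↦ ?_
  rw [← neg_one_mul q⁻¹, mul_zpow, inv_zpow', ← zpow_natCast q 3, ← zpow_mul, mul_assoc,
    ← zpow_add₀ hq0]
  congr 2
  push_cast; ring

/-- **Gauss's identity** for the generating function of the triangular numbers. -/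
theorem hasSum_eulerFun_sq_div (hq : ‖q‖ < 1) (hq0 : q ≠ 0) :
    HasSum (fun k : ℤ ↦ 2⁻¹ * q ^ triangular k) (eulerFun (q ^ 2) ^ 2 / eulerFun q) := by
  have h := (hasSum_tripleProduct hq hq0 one_ne_zero).mul_left (2⁻¹ : ℂ)
  simp only [one_zpow, one_mul] at h
  convert! h using 1
  rw [div_eq_iff (eulerFun_ne_zero hq), mul_assoc, mul_comm _ (eulerFun q),
    eulerFun_mul_thetaProd_one hq]
  ring

/-- The generating function of the 3-cores as a theta series of a binary quadratic form: compare the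
constant terms in `ζ` of the triple product at `(ζ, q)` and of the product of the triple products at
`(ζ q⁻ⁱ, q³)`, `i = 0, 1, 2`. -/
theorem hasSum_eulerFun_cube_div (hq : ‖q‖ < 1) (hq0 : q ≠ 0) :
    HasSum (fun x : ℤ × ℤ ↦ q ^ (3 * (x.1 ^ 2 + x.1 * x.2 + x.2 ^ 2) - x.1 - 2 * x.2))
      (eulerFun (q ^ 3) ^ 3 / eulerFun q) := by
  have hq3 : ‖q ^ 3‖ < 1 := by rw [norm_pow]; exact pow_lt_one₀ (norm_nonneg _) hq (by norm_num)
  have hq30 := pow_ne_zero 3 hq0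
  set R := eulerFun (q ^ 3) ^ 3 / eulerFun q with hR
  -- `f i k` is the coefficient of `ζ ^ k` in the triple product at `(ζ q⁻ⁱ, q³)`.
  obtain ⟨f, hf⟩ : ∃ f : ℕ → ℤ → ℂ, ∀ i k, f i k = q ^ (3 * triangular k - i * k) :=
    ⟨_, fun _ _ ↦ rfl⟩
  have hJ : ∀ (i : ℕ) (ζ : ℂ), ζ ≠ 0 → HasSum (fun k : ℤ ↦ f i k * ζ ^ k)
      (eulerFun (q ^ 3) * thetaProd (ζ * (q ^ i)⁻¹) (q ^ 3)) := by
    intro i ζ hζ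
    refine (hasSum_tripleProduct hq3 hq30 (ζ := ζ * (q ^ i)⁻¹)
      (mul_ne_zero hζ (inv_ne_zero (pow_ne_zero i hq0)))).congr_fun fun k ↦ ?_
    rw [hf, mul_zpow, inv_zpow', ← zpow_natCast q 3, ← zpow_natCast q i, ← zpow_mul, ← zpow_mul,
      mul_assoc, ← zpow_add₀ hq0, mul_comm]
    congr 2
    push_cast; ring
  have hs : ∀ i : ℕ, Summable (f i) := fun i ↦ by
    simpa using (hJ i 1 one_ne_zero).summable
  set w : (ℤ × ℤ) × ℤ → ℂ := fun x ↦ f 0 x.1.1 * f 1 x.1.2 * f 2 x.2 with hw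
  have hws : Summable w := by
    have h01 : Summable fun x : ℤ × ℤ ↦ f 0 x.1 * f 1 x.2 :=
      summable_mul_of_summable_norm (hs 0).norm (hs 1).norm
    exact summable_mul_of_summable_norm (f := fun x : ℤ × ℤ ↦ f 0 x.1 * f 1 x.2) h01.norm
      (hs 2).norm
  have hF : ∀ ζ : ℂ, ‖ζ‖ = 1 → HasSum (fun x ↦ w x * ζ ^ (x.1.1 + x.1.2 + x.2))
      (R * (eulerFun q * thetaProd ζ q)) := by
    intro ζ hζ1
    have hζ : ζ ≠ 0 := norm_pos_iff.1 (hζ1 ▸ one_pos)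
    have k0 := hJ 0 ζ hζ
    have k1 := hJ 1 ζ hζ
    have k2 := hJ 2 ζ hζ
    have h012 := (k0.mul_complex k1).mul_complex k2
    convert! h012 using 1
    · funext x
      simp only [hw]
      rw [zpow_add₀ hζ, zpow_add₀ hζ]
      ring
    · rw [thetaProd_three hq hq0 hζ, hR]
      have := eulerFun_ne_zero hq
      simp only [pow_zero, inv_one, mul_one, pow_one]
      field_simp
  have hG : ∀ ζ : ℂ, ‖ζ‖ = 1 → HasSum (fun k : ℤ ↦ R * q ^ triangular k * ζ ^ k)
      (R * (eulerFun q * thetaProd ζ q)) := by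
    intro ζ hζ1
    have hζ : ζ ≠ 0 := norm_pos_iff.1 (hζ1 ▸ one_pos)
    refine ((hasSum_tripleProduct hq hq0 hζ).mul_left R).congr_fun fun k ↦ ?_
    ring
  have hGs : Summable fun k : ℤ ↦ R * q ^ triangular k := by
    simpa using (hG 1 norm_one).summable
  have h1 := hasSum_constantTerm hws (fun x ↦ x.1.1 + x.1.2 + x.2) hF
  have h2 := hasSum_constantTerm hGs (fun k ↦ k) hG
  have h3 : HasSum (fun k : ℤ ↦ if k = 0 then R * q ^ triangular k else 0) R := by
    convert! hasSum_ite_eq (0 : ℤ) R using 2 with k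
    split_ifs with h
    · simp [h, triangular]
    · rfl
  rw [← h3.unique h2] at h1
  -- The terms free of `ζ` are those with `k₀ = -k₁ - k₂`.
  have hinj : Function.Injective fun x : ℤ × ℤ ↦ ((-x.1 - x.2, x.1), x.2) := by
    rintro ⟨a, b⟩ ⟨c, d⟩ h
    simp only [Prod.mk.injEq] at h
    ext <;> simp [h]
  refine ((hinj.hasSum_iff ?_).2 h1).congr_fun fun x ↦ ?_
  · rintro ⟨⟨a, b⟩, c⟩ hx
    refine if_neg fun h ↦ hx ⟨(b, c), ?_⟩
    simp only [Prod.mk.injEq, and_true]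
    simp only at h
    linarith
  · simp only [Function.comp_apply, hw]
    rw [if_pos (by ring), hf, hf, hf, ← zpow_add₀ hq0, ← zpow_add₀ hq0]
    congr 1
    have a1 := two_mul_triangular (-x.1 - x.2)
    have a2 := two_mul_triangular x.1
    have a3 := two_mul_triangular x.2
    push_cast
    linarith

end

/-! ### Eta quotients -/

/-- Exponents are integers here; the condition `he` forces them to be nonnegative. Terms with the same
exponent are collected into the coefficient of a power series, which is therefore supported on a set
of density zero. -/
theorem isLacunary_of_hasSum {ι : Type*} {f : UpperHalfPlane → ℂ} {a : ι → ℂ} {e : ι → ℤ}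
    {K D : ℕ} (hK : 0 < K) (hD : 0 < D) (he : ∀ i, ∃ u v : ℤ, K * e i = u ^ 2 + D * v ^ 2)
    (hf : ∀ z : UpperHalfPlane,
      HasSum (fun i ↦ a i * Complex.exp (2 * Real.pi * Complex.I * (z : ℂ)) ^ e i) (f z)) :
    IsLacunary f := by
  have he0 : ∀ i, 0 ≤ e i := fun i ↦ by
    obtain ⟨u, v, h⟩ := he i
    have hK' : (0 : ℤ) < K := by exact_mod_cast hK
    have : 0 ≤ K * e i := h ▸ by positivity
    exact nonneg_of_mul_nonneg_right this hK'
  refine ⟨fun n ↦ ∑' i : (fun i ↦ (e i).toNat) ⁻¹' {n}, a i, fun z ↦ ?_,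
    lacunaryCoeffs_of_tendsto (fun n hn ↦ ?_) (tendsto_quadForm hD hK)⟩
  · have h1 := ((Equiv.sigmaFiberEquiv fun i ↦ (e i).toNat).hasSum_iff).2 (hf z)
    refine (h1.sigma fun n ↦ (h1.summable.sigma_factor n).hasSum).congr_fun fun n ↦ ?_
    rw [← tsum_mul_right]
    refine tsum_congr fun i ↦ ?_
    have hi : (e i.1).toNat = n := i.2
    simp only [Function.comp_apply, Equiv.sigmaFiberEquiv, Equiv.coe_fn_mk]
    congr 1
    rw [← zpow_natCast, ← Int.toNat_of_nonneg (he0 i.1), hi]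
  · by_contra hS
    -- Off the set the coefficient is an empty sum.
    refine hn ?_
    have : IsEmpty ((fun i ↦ (e i).toNat) ⁻¹' {n}) := by
      refine ⟨fun i ↦ hS ?_⟩
      obtain ⟨u, v, h⟩ := he i.1
      have hi : (e i.1).toNat = n := i.2
      exact ⟨u, v, by rw [← hi, Int.toNat_of_nonneg (he0 _), h]⟩
    exact tsum_empty

section

variable (z : UpperHalfPlane)

local notation "𝐪" => Complex.exp (2 * Real.pi * Complex.I * (z : ℂ))

theorem norm_exp_pow_lt_one {m : ℕ} (hm : 0 < m) : ‖𝐪 ^ (24 * m)‖ < 1 := by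
  rw [norm_pow]
  exact pow_lt_one₀ (norm_nonneg _) (UpperHalfPlane.norm_exp_two_pi_I_lt_one z) (by omega)

theorem eta_eq_mul_eulerFun (m : ℕ) :
    ModularForm.eta (24 * (m : ℂ) * z) = 𝐪 ^ m * eulerFun (𝐪 ^ (24 * m)) := by
  unfold ModularForm.eta eulerFun
  congr 1
  · rw [Function.Periodic.qParam, ← Complex.exp_nat_mul]
    congr 1
    push_cast
    field_simp
  · refine tprod_congr fun n ↦ ?_
    rw [ModularForm.eta_q_eq_pow, ← Complex.exp_nat_mul
      (2 * Real.pi * Complex.I * (z : ℂ)) (24 * m)]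
    congr 3
    push_cast; ring

theorem hasSum_eta {m : ℕ} (hm : 0 < m) :
    HasSum (fun k : ℤ ↦ (-1) ^ k * 𝐪 ^ (m * (6 * k + 1) ^ 2)) (ModularForm.eta (24 * (m : ℂ) * z)) := by
  have hq0 : 𝐪 ≠ 0 := Complex.exp_ne_zero _
  rw [eta_eq_mul_eulerFun]
  refine ((hasSum_eulerFun (norm_exp_pow_lt_one z hm) (pow_ne_zero _ hq0)).mul_left _).congr_fun
    fun k ↦ ?_
  rw [mul_left_comm, ← zpow_natCast 𝐪 (24 * m), ← zpow_mul, ← zpow_natCast 𝐪 m, ← zpow_add₀ hq0]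
  congr 2
  have := two_mul_triangular k
  push_cast
  linear_combination -36 * m * this

theorem hasSum_eta_cube {m : ℕ} (hm : 0 < m) :
    HasSum (fun k : ℤ ↦ k * (-1) ^ k * 𝐪 ^ (3 * m * (2 * k + 1) ^ 2))
      (ModularForm.eta (24 * (m : ℂ) * z) ^ 3) := by
  have hq0 : 𝐪 ≠ 0 := Complex.exp_ne_zero _
  rw [eta_eq_mul_eulerFun, mul_pow]
  refine ((hasSum_eulerFun_cube (norm_exp_pow_lt_one z hm) (pow_ne_zero _ hq0)).mul_left
    _).congr_fun fun k ↦ ?_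
  rw [mul_left_comm, ← zpow_natCast 𝐪 (24 * m), ← zpow_mul, ← pow_mul, ← zpow_natCast 𝐪 (m * 3),
    ← zpow_add₀ hq0]
  congr 2
  have := two_mul_triangular k
  push_cast
  linear_combination -12 * m * this

theorem hasSum_eta_sq_div :
    HasSum (fun k : ℤ ↦ 2⁻¹ * 𝐪 ^ (3 * (2 * k + 1) ^ 2))
      (ModularForm.eta (24 * ((2 : ℕ) : ℂ) * z) ^ 2 / ModularForm.eta (24 * ((1 : ℕ) : ℂ) * z)) := by
  have hq0 : 𝐪 ≠ 0 := Complex.exp_ne_zero _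
  have h := (hasSum_eulerFun_sq_div (norm_exp_pow_lt_one z one_pos)
    (pow_ne_zero _ hq0)).mul_left (𝐪 ^ 3)
  rw [eta_eq_mul_eulerFun, eta_eq_mul_eulerFun]
  convert! h using 1
  · funext k
    rw [mul_left_comm, ← zpow_natCast 𝐪 (24 * 1), ← zpow_mul, ← zpow_natCast 𝐪 3, ← zpow_add₀ hq0]
    congr 2
    have := two_mul_triangular k
    push_cast
    linear_combination -12 * this
  · have := eulerFun_ne_zero (norm_exp_pow_lt_one z one_pos)
    rw [mul_one] at this
    rw [← pow_mul, mul_one]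
    field_simp

theorem hasSum_eta_cube_div :
    HasSum (fun x : ℤ × ℤ ↦
        𝐪 ^ (8 + 24 * (3 * (x.1 ^ 2 + x.1 * x.2 + x.2 ^ 2) - x.1 - 2 * x.2)))
      (ModularForm.eta (24 * ((3 : ℕ) : ℂ) * z) ^ 3 / ModularForm.eta (24 * ((1 : ℕ) : ℂ) * z)) := by
  have hq0 : 𝐪 ≠ 0 := Complex.exp_ne_zero _
  have h := (hasSum_eulerFun_cube_div (norm_exp_pow_lt_one z one_pos)
    (pow_ne_zero _ hq0)).mul_left (𝐪 ^ 8)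
  rw [eta_eq_mul_eulerFun, eta_eq_mul_eulerFun]
  convert! h using 1
  · funext k
    rw [← zpow_natCast 𝐪 (24 * 1), ← zpow_mul, ← zpow_natCast 𝐪 8, ← zpow_add₀ hq0]
    congr 1
  · have := eulerFun_ne_zero (norm_exp_pow_lt_one z one_pos)
    rw [mul_one] at this
    rw [← pow_mul, mul_one]
    field_simp

theorem etaF_eq (a b c : ℕ) : etaF a b c z = ModularForm.eta (24 * (a : ℂ) * z) ^ a *
    ModularForm.eta (24 * ((a * c : ℕ) : ℂ) * z) ^ ((b : ℤ) - a) /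
      ModularForm.eta (24 * ((1 : ℕ) : ℂ) * z) := by
  simp [etaF, mul_assoc]

/-- For `a = 1` the factor `η(24 z)` cancels the denominator. -/
theorem etaF_one (b c : ℕ) :
    etaF 1 b c z = ModularForm.eta (24 * (c : ℂ) * z) ^ ((b : ℤ) - 1) := by
  have h : ModularForm.eta (24 * ((1 : ℕ) : ℂ) * z) ≠ 0 := by
    rw [eta_eq_mul_eulerFun]
    exact mul_ne_zero (pow_ne_zero _ (Complex.exp_ne_zero _))
      (eulerFun_ne_zero (norm_exp_pow_lt_one z one_pos))
  rw [etaF_eq, pow_one, one_mul, mul_div_cancel_left₀ _ h, Nat.cast_one]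

end

theorem isLacunary_etaF_one_three {c : ℕ} (hc : 0 < c) : IsLacunary (etaF 1 3 c) := by
  refine isLacunary_of_hasSum (ι := ℤ × ℤ) (K := c) (D := 1)
    (a := fun x ↦ (-1) ^ x.1 * (-1) ^ x.2)
    (e := fun x ↦ c * (6 * x.1 + 1) ^ 2 + c * (6 * x.2 + 1) ^ 2) hc one_pos
    (fun x ↦ ⟨c * (6 * x.1 + 1), c * (6 * x.2 + 1), by push_cast; ring⟩) fun z ↦ ?_
  have h := (hasSum_eta z hc).mul_complex (hasSum_eta z hc)
  rw [etaF_one, show ((3 : ℕ) : ℤ) - 1 = (2 : ℕ) by norm_num, zpow_natCast, sq]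
  refine h.congr_fun fun x ↦ ?_
  rw [zpow_add₀ (Complex.exp_ne_zero _)]
  ring

theorem isLacunary_etaF_one_five {c : ℕ} (hc : 0 < c) : IsLacunary (etaF 1 5 c) := by
  refine isLacunary_of_hasSum (ι := ℤ × ℤ) (K := c) (D := 3)
    (a := fun x ↦ (-1) ^ x.1 * (x.2 * (-1) ^ x.2))
    (e := fun x ↦ c * (6 * x.1 + 1) ^ 2 + 3 * c * (2 * x.2 + 1) ^ 2) hc (by norm_num)
    (fun x ↦ ⟨c * (6 * x.1 + 1), c * (2 * x.2 + 1), by push_cast; ring⟩) fun z ↦ ?_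
  have h := (hasSum_eta z hc).mul_complex (hasSum_eta_cube z hc)
  rw [etaF_one, show ((5 : ℕ) : ℤ) - 1 = (4 : ℕ) by norm_num, zpow_natCast, pow_succ']
  refine h.congr_fun fun x ↦ ?_
  rw [zpow_add₀ (Complex.exp_ne_zero _)]
  ring

theorem isLacunary_etaF_two_three {c : ℕ} (hc : 0 < c) : IsLacunary (etaF 2 3 c) := by
  refine isLacunary_of_hasSum (ι := ℤ × ℤ) (K := 3) (D := 6 * c)
    (a := fun x ↦ 2⁻¹ * (-1) ^ x.2)
    (e := fun x ↦ 3 * (2 * x.1 + 1) ^ 2 + (2 * c : ℕ) * (6 * x.2 + 1) ^ 2) (by norm_num) (by omega)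
    (fun x ↦ ⟨3 * (2 * x.1 + 1), 6 * x.2 + 1, by push_cast; ring⟩) fun z ↦ ?_
  have h := (hasSum_eta_sq_div z).mul_complex (hasSum_eta z (m := 2 * c) (by omega))
  rw [etaF_eq, show ((3 : ℕ) : ℤ) - (2 : ℕ) = 1 by norm_num, zpow_one, mul_div_right_comm]
  refine h.congr_fun fun x ↦ ?_
  rw [zpow_add₀ (Complex.exp_ne_zero _)]
  ring

theorem isLacunary_etaF_two_five {c : ℕ} (hc : 0 < c) : IsLacunary (etaF 2 5 c) := by
  refine isLacunary_of_hasSum (ι := ℤ × ℤ) (K := 3) (D := 18 * c)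
    (a := fun x ↦ 2⁻¹ * (x.2 * (-1) ^ x.2))
    (e := fun x ↦ 3 * (2 * x.1 + 1) ^ 2 + 3 * (2 * c : ℕ) * (2 * x.2 + 1) ^ 2) (by norm_num)
    (by omega) (fun x ↦ ⟨3 * (2 * x.1 + 1), 2 * x.2 + 1, by push_cast; ring⟩) fun z ↦ ?_
  have h := (hasSum_eta_sq_div z).mul_complex (hasSum_eta_cube z (m := 2 * c) (by omega))
  rw [etaF_eq, show ((5 : ℕ) : ℤ) - (2 : ℕ) = (3 : ℕ) by norm_num, zpow_natCast,
    mul_div_right_comm]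
  refine h.congr_fun fun x ↦ ?_
  rw [zpow_add₀ (Complex.exp_ne_zero _)]
  ring

/-- The exponent is `8 (X² + X Y + Y²)` with `X = 3 x` and `Y = 3 y - 1`, and twice this is
`(2 (X + 2 Y))² + 3 (2 X)²`. -/
theorem isLacunary_etaF_three_three (c : ℕ) : IsLacunary (etaF 3 3 c) := by
  refine isLacunary_of_hasSum (ι := ℤ × ℤ) (K := 2) (D := 3) (a := fun _ ↦ 1)
    (e := fun x ↦ 8 + 24 * (3 * (x.1 ^ 2 + x.1 * x.2 + x.2 ^ 2) - x.1 - 2 * x.2))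
    (by norm_num) (by norm_num)
    (fun x ↦ ⟨2 * (3 * x.1 + 2 * (3 * x.2 - 1)), 2 * (3 * x.1), by push_cast; ring⟩) fun z ↦ ?_
  rw [etaF_eq, sub_self, zpow_zero, mul_one]
  simpa only [one_mul] using hasSum_eta_cube_div z

theorem theorem1 :
    (∀ a c : ℕ, (a = 1 ∨ a = 2 ∨ a = 3) → 1 ≤ c → IsLacunary (etaF a 3 c)) ∧
    (∀ a c : ℕ, (a = 1 ∨ a = 2) → 1 ≤ c → IsLacunary (etaF a 5 c)) ∧
    (∀ a : ℕ, (a = 1 ∨ a = 2 ∨ a = 3) →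
      {p : ℕ × ℕ | 1 ≤ p.1 ∧ Odd p.1 ∧ 1 ≤ p.2 ∧ IsLacunary (etaF a p.1 p.2)}.Infinite) := by
  have h3 : ∀ a c : ℕ, (a = 1 ∨ a = 2 ∨ a = 3) → 1 ≤ c → IsLacunary (etaF a 3 c) := by
    rintro a c (rfl | rfl | rfl) hc
    exacts [isLacunary_etaF_one_three hc, isLacunary_etaF_two_three hc,
      isLacunary_etaF_three_three c]
  refine ⟨h3, ?_, fun a ha ↦ ?_⟩
  · rintro a c (rfl | rfl) hc
    exacts [isLacunary_etaF_one_five hc, isLacunary_etaF_two_five hc]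
  · refine Set.infinite_of_injective_forall_mem (f := fun c : ℕ ↦ (3, c + 1)) (fun c d h ↦ ?_)
      fun c ↦ ⟨by norm_num, ⟨1, by norm_num⟩, by simp, h3 a _ ha (by simp)⟩
    simpa using h
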